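/- Let $G=(V,E)$ be an undirected graph on $V=\{1,\dots,n\}$, $n\ge 1$, and let $P=[P_{ij}]$ be a doubly stochastic $n\times n$ matrix such that $P_{ij}=0$ whenever $i\ne j$ and $(i,j)\notin E$. The conductance of $P$ is $$\Phi(P)=\min_{S\subset V,\;0<|S|\le n/2}\ \frac{\sum_{i\in S,\,j\notin S}P_{ij}}{|S|}$$ (the minimum over the empty family, which occurs for $n=1$, being $\infty$). The gossip algorithm $\mathrm{SPREAD}(P)$ works as follows. At time $0$, each node $i$ holds only its own message $m_i$. Whenever node $i$ initiates a communication, it contacts a node $u$, chosen to be $j$ with probability $P_{ij}$ independently of all other random choices, and $i$ and $u$ exchange all the messages that they hold just before the communication, so that each of them obtains the messages of both. Two time models are considered. * Synchronous: in each of the time slots $1,2,\dots$ every node initiates one communication, all communications of a slot being simultaneous (a node receives the messages of the node that it contacts and of all the nodes that contact it). Absolute time is the number of time slots. * Asynchronous: a global clock ticks according to a Poisson process of rate $n$ (the times between ticks, and from time $0$ to the first tick, are independent exponential random variables of rate $n$). On each tick one node, chosen uniformly at random and independently of everything else, initiates a communication. Let $S_i(t)$ be the set of nodes that have the message $m_i$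 after the communications that occur up to absolute time $t$. For $\delta\in(0,1)$, the $\delta$-information-spreading time is $$T^{\mathrm{spr}}(\delta)=\inf\Big\{t\ge 0:\ \Pr\Big(\bigcup_{i=1}^n\{S_i(t)\ne V\}\Big)\le\delta\Big\}.$$ Then there is a universal constant $C>0$ (independent of $n$, $G$, $P$ and $\delta$) such that, for all such $n$, $G$, $P$ and every $\delta\in(0,1)$, in the asynchronous as well as in the synchronous time model, $\mathrm{SPREAD}(P)$ satisfies $$T^{\mathrm{spr}}(\delta)\ \le\ C\,\frac{\log n+\log\delta^{-1}}{\Phi(P)},$$ where the right-hand side is read as $\infty$ if $\Phi(P)=0$ and as $0$ if $\Phi(P)=\infty$. -/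

import Mathlib

open MeasureTheory ProbabilityTheory
open scoped NNReal ENNReal

namespace Gossip

noncomputable section

variable {n : ℕ}

/-- The conductance of a stochastic matrix: the minimum, over the sets `S` of nodes with
`0 < |S| ≤ n / 2`, of `(∑ i ∈ S, ∑ j ∉ S, P i j) / |S|`, as an extended nonnegative real
(for `n = 1` there is no such `S`, and the minimum over the empty family is `∞`). -/
def conductance (P : Matrix (Fin n) (Fin n) ℝ) : ℝ≥0∞ :=
  ⨅ (S : Finset (Fin n)) (_ : 0 < S.card ∧ 2 * S.card ≤ n),
    ENNReal.ofReal ((∑ i ∈ S, ∑ j ∈ Sᶜ, P i j) / S.card)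

/-! ### Messages and their exchange -/

/-- A state of the network: `M i` is the set of messages that node `i` holds. The message that
node `v` has at the start is identified with `v`. -/
abbrev State (n : ℕ) : Type := Fin n → Set (Fin n)

/-- At time `0`, node `i` holds its own message only. -/
def initialState : State n := fun i => {i}

/-- Node `i` contacts node `u`, and both of them end up with the union of their messages.
Contacting oneself (`u = i`) has no effect. -/
def exchange (M : State n) (i u : Fin n) : State n :=
  fun j => if j = i ∨ j = u then M i ∪ M u else M j

/-- All nodes communicate in the same time slot, node `i` contacting node `c i`. Every contact is
an exchange in both directions of the messages held just before the slot, so that node `j` receives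
the messages of the node that it contacts and of all the nodes that contact it. -/
def exchangeAll (M : State n) (c : Fin n → Fin n) : State n :=
  fun j => M j ∪ M (c j) ∪ ⋃ (i : Fin n) (_ : c i = j), M i

/-- The set of nodes that hold the message of node `v`. -/
def holders (M : State n) (v : Fin n) : Set (Fin n) := {j | v ∈ M j}

/-! ### The time to spread all messages -/

/-- The `δ`-information-spreading time of a random process `S` on the probability space `(Ω, μ)`,
where `S t ω v` is the set of nodes that have the message of node `v` at absolute time `t`: the
infimum of the times `t` at which the probability that some message has not reached all the nodes
is at most `δ` (`∞` if there is no such time). -/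
def spreadingTime {Ω : Type*} [MeasurableSpace Ω] (μ : Measure Ω)
    (S : ℝ≥0 → Ω → Fin n → Set (Fin n)) (δ : ℝ) : ℝ≥0∞ :=
  ⨅ (t : ℝ≥0) (_ : μ {ω | ∃ v, S t ω v ≠ Set.univ} ≤ ENNReal.ofReal δ), (t : ℝ≥0∞)

/-- The law of the node that node `i` contacts: node `j` with probability `P i j`. -/
def contactPMF (P : Matrix (Fin n) (Fin n) ℝ) (hP : P ∈ Matrix.rowStochastic ℝ (Fin n))
    (i : Fin n) : PMF (Fin n) :=
  PMF.ofFintype (fun j => ENNReal.ofReal (P i j)) (by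
    rw [← ENNReal.ofReal_sum_of_nonneg
      (fun j _ => Matrix.nonneg_of_mem_rowStochastic hP),
      Matrix.sum_row_of_mem_rowStochastic hP, ENNReal.ofReal_one])

/-! ### The synchronous time model -/

/-- The law of all random choices in the synchronous model. A sample is `c : ℕ → Fin n → Fin n`,
where `c t i` is the node that node `i` contacts in time slot `t + 1`. All the choices are
independent, and `c t i` has the law `contactPMF P hP i`. -/
def syncLaw (P : Matrix (Fin n) (Fin n) ℝ) (hP : P ∈ Matrix.rowStochastic ℝ (Fin n)) :
    Measure (ℕ → Fin n → Fin n) :=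
  Measure.infinitePi fun _ : ℕ => Measure.pi fun i : Fin n => (contactPMF P hP i).toMeasure

instance (P : Matrix (Fin n) (Fin n) ℝ) (hP : P ∈ Matrix.rowStochastic ℝ (Fin n)) :
    IsProbabilityMeasure (syncLaw P hP) := by
  unfold syncLaw
  infer_instance

/-- The state after a number of time slots. -/
def syncState (c : ℕ → Fin n → Fin n) : ℕ → State n
  | 0 => initialState
  | t + 1 => exchangeAll (syncState c t) (c t)

/-- The nodes that have the message of `v` at absolute time `t`, in the synchronous model: absolute
time is the number of time slots. -/
def syncSpread (t : ℝ≥0) (c : ℕ → Fin n → Fin n) (v : Fin n) : Set (Fin n) :=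
  holders (syncState c ⌊t⌋₊) v

/-- The `δ`-information-spreading time of the push–pull algorithm `SPREAD(P)` in the synchronous
time model. -/
def syncSpreadingTime (P : Matrix (Fin n) (Fin n) ℝ) (hP : P ∈ Matrix.rowStochastic ℝ (Fin n))
    (δ : ℝ) : ℝ≥0∞ :=
  spreadingTime (syncLaw P hP) syncSpread δ

/-! ### The asynchronous time model -/

/-- The law of a communication on a clock tick, as a pair (initiator, contacted node): the initiator
`i` is uniformly random, and the contacted node has the law `contactPMF P hP i`. -/
def tickPMF [NeZero n] (P : Matrix (Fin n) (Fin n) ℝ) (hP : P ∈ Matrix.rowStochastic ℝ (Fin n)) :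
    PMF (Fin n × Fin n) :=
  (PMF.uniformOfFintype (Fin n)).bind fun i => (contactPMF P hP i).map (Prod.mk i)

/-- The law of all the randomness in the asynchronous model. A sample is
`ω : ℕ → ℝ × (Fin n × Fin n)`, where `(ω k).1` is the waiting time between the ticks `k` and `k + 1`
of the global clock and `(ω k).2` is the pair of nodes that communicate on tick `k + 1`. The waiting
times are exponential of rate `n`, so that the clock is a Poisson process of rate `n`, and waiting
times and communications are all independent. -/
def asyncLaw [NeZero n] (P : Matrix (Fin n) (Fin n) ℝ) (hP : P ∈ Matrix.rowStochastic ℝ (Fin n)) :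
    Measure (ℕ → ℝ × (Fin n × Fin n)) :=
  Measure.infinitePi fun _ : ℕ => (expMeasure (n : ℝ)).prod (tickPMF P hP).toMeasure

instance [NeZero n] (P : Matrix (Fin n) (Fin n) ℝ) (hP : P ∈ Matrix.rowStochastic ℝ (Fin n)) :
    IsProbabilityMeasure (asyncLaw P hP) := by
  have : IsProbabilityMeasure (expMeasure (n : ℝ)) :=
    isProbabilityMeasure_expMeasure (Nat.cast_pos.mpr (NeZero.pos n))
  unfold asyncLaw
  infer_instance

/-- The absolute time of tick `k` of the global clock (and `0` for `k = 0`). -/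
def tickTime (ω : ℕ → ℝ × (Fin n × Fin n)) (k : ℕ) : ℝ :=
  ∑ i ∈ Finset.range k, (ω i).1

/-- The state at the end of clock tick `k`. -/
def tickState (ω : ℕ → ℝ × (Fin n × Fin n)) : ℕ → State n
  | 0 => initialState
  | k + 1 => exchange (tickState ω k) (ω k).2.1 (ω k).2.2

/-- The nodes that have the message of `v` at absolute time `t`, in the asynchronous model: those
that have it at the end of some tick that occurs by time `t`, the start being tick `0`. -/
def asyncSpread (t : ℝ≥0) (ω : ℕ → ℝ × (Fin n × Fin n)) (v : Fin n) : Set (Fin n) :=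
  {j | ∃ k : ℕ, tickTime ω k ≤ t ∧ j ∈ holders (tickState ω k) v}

/-- The `δ`-information-spreading time of the push–pull algorithm `SPREAD(P)` in the asynchronous
time model. -/
def asyncSpreadingTime [NeZero n] (P : Matrix (Fin n) (Fin n) ℝ)
    (hP : P ∈ Matrix.rowStochastic ℝ (Fin n)) (δ : ℝ) : ℝ≥0∞ :=
  spreadingTime (asyncLaw P hP) asyncSpread δ

/-- A doubly stochastic matrix is stochastic. -/
theorem rowStochastic_of_doubly {P : Matrix (Fin n) (Fin n) ℝ}
    (hP : P ∈ doublyStochastic ℝ (Fin n)) : P ∈ Matrix.rowStochastic ℝ (Fin n) :=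
  (mem_doublyStochastic_iff_mem_rowStochastic_and_mem_colStochastic.mp hP).1

end

end Gossip

/-!
For the message of a node `v`, let `A` be the set of nodes that hold it. The proof follows the
potential `|Aᶜ| / |A|`, which is at most `n` at the start and at least `1 / n` as long as some node
lacks the message. Only pulls, by which an uninformed initiator learns from an informed contact, are
needed; the messages that are pushed can only decrease the potential further (`potential_anti`).

As `P` is doubly stochastic, the flow into `A` equals the flow out of `A`, so that it is at least
`Φ * min |A| |Aᶜ|` (`conductance_mul_min_le`). In one synchronous slot, the number `X` of nodes that
pull the message is a sum of independent indicators, of mean this flow `m` and with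
`𝔼 X ^ 2 ≤ m + m ^ 2`. Bounding `1 / (|A| + X)` by means of a tangent line shows that the expected
potential decreases by the factor `1 - Φ / 3` (`lintegral_potential_pulled_le`). In one asynchronous
tick, at most one node pulls, with probability `m / n`, and the factor is `1 - Φ / (2 * n)`
(`lintegral_potential_pullTick_le`). This is uniform in `A`, so no distinction between an early and a
late phase of the spreading is needed.

The dynamics is driven by i.i.d. inputs, so the factors multiply (`lintegral_run_le`), and Markov's
inequality and a union bound over the messages bound the probability of failure by `n ^ 3` times the
`K`-th power of the factor (`measure_exists_ne_univ_le`). In the asynchronous model, a Chernoff bound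
for the sum of exponential waiting times shows moreover that `K` ticks are over by time `4 * K / n`
except with probability `exp (-K)` (`asyncLaw_tickTime_le`).
-/


namespace Gossip

/-! ### Iterated random maps -/

section Iteration

variable {X Z : Type*}

/-- The state after `k` steps of the dynamics `step`, started at `z` and driven by the inputs
`ω 0, ω 1, …`. -/
def run (step : Z → X → Z) (z : Z) (ω : ℕ → X) : ℕ → Z
  | 0 => z
  | k + 1 => step (run step z ω k) (ω k)

theorem run_succ' (step : Z → X → Z) (z : Z) (ω : ℕ → X) (k : ℕ) :
    run step z ω (k + 1) = run step (step z (ω 0)) (fun i => ω (i + 1)) k := by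
  induction k with
  | zero => rfl
  | succ k ih => rw [run, ih]; rfl

variable [MeasurableSpace X] [MeasurableSpace Z]

theorem measurable_run {step : Z → X → Z} (hstep : Measurable (Function.uncurry step)) (z : Z)
    (k : ℕ) : Measurable fun ω => run step z ω k := by
  induction k with
  | zero => exact measurable_const
  | succ k ih => exact hstep.comp (ih.prodMk (measurable_pi_apply k))

theorem measurable_natCons :
    Measurable (fun p : X × (ℕ → X) => (fun i => Nat.casesOn i p.1 p.2 : ℕ → X)) := by
  refine measurable_pi_iff.2 fun i => ?_
  cases i with
  | zero => exact measurable_fst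
  | succ i => exact (measurable_pi_apply i).comp measurable_snd

/-- A sequence `x, ω 0, ω 1, …` with `x` and `ω` independent is again an i.i.d. sequence. -/
theorem map_natCons_infinitePi (ν : Measure X) [IsProbabilityMeasure ν] :
    (ν.prod (Measure.infinitePi fun _ : ℕ => ν)).map
        (fun p : X × (ℕ → X) => (fun i => Nat.casesOn i p.1 p.2 : ℕ → X)) =
      Measure.infinitePi fun _ : ℕ => ν := by
  have hm := measurable_natCons (X := X)
  refine Measure.eq_infinitePi _ fun s t ht => ?_
  classical
  -- Enlarging the index set to an initial segment makes it split into `0` and a shifted segment.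
  obtain ⟨k, hk⟩ : ∃ k, s ⊆ Finset.range (k + 1) :=
    ⟨s.sup id, fun i hi => Finset.mem_range.2 (Nat.lt_succ_of_le (Finset.le_sup (f := id) hi))⟩
  set t' : ℕ → Set X := fun i => if i ∈ s then t i else Set.univ with ht'
  have hmt' : ∀ i, MeasurableSet (t' i) := by
    intro i
    by_cases h : i ∈ s <;> simp [ht', h, ht]
  have hprod : ∏ i ∈ s, ν (t i) = ∏ i ∈ Finset.range (k + 1), ν (t' i) := by
    rw [← Finset.prod_subset hk]
    · exact Finset.prod_congr rfl fun i hi => by simp [ht', hi]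
    · intro i _ hi
      simp [ht', hi]
  have hset : (fun p : X × (ℕ → X) => (fun i => Nat.casesOn i p.1 p.2 : ℕ → X)) ⁻¹'
      ((s : Set ℕ).pi t) = t' 0 ×ˢ ((Finset.range k : Set ℕ).pi fun i => t' (i + 1)) := by
    ext ⟨x, ω⟩
    simp only [Set.mem_preimage, Set.mem_pi, Set.mem_prod, Finset.mem_coe, Finset.mem_range]
    constructor
    · intro h
      refine ⟨?_, fun i _ => ?_⟩
      · by_cases h0 : 0 ∈ s
        · simpa [ht', h0] using h 0 h0
        · simp [ht', h0]
      · by_cases h0 : i + 1 ∈ s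
        · simpa [ht', h0] using h _ h0
        · simp [ht', h0]
    · rintro ⟨h0, h1⟩ i hi
      cases i with
      | zero => simpa [ht', hi] using h0
      | succ i => simpa [ht', hi] using h1 i (by simpa using hk hi)
  rw [Measure.map_apply hm (MeasurableSet.pi s.countable_toSet fun i _ => ht i), hset,
    Measure.prod_prod, Measure.infinitePi_pi _ (fun i _ => hmt' _), hprod,
    Finset.prod_range_succ', mul_comm]

/-- If every step multiplies the expectation of `f` by at most `a`, then `k` steps with independent
inputs multiply it by at most `a ^ k`. -/
theorem lintegral_run_le (ν : Measure X) [IsProbabilityMeasure ν] {step : Z → X → Z}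
    (hstep : Measurable (Function.uncurry step)) {f : Z → ℝ≥0∞} (hf : Measurable f) {a : ℝ≥0∞}
    (h : ∀ z, ∫⁻ x, f (step z x) ∂ν ≤ a * f z) (z : Z) (k : ℕ) :
    ∫⁻ ω, f (run step z ω k) ∂(Measure.infinitePi fun _ : ℕ => ν) ≤ a ^ k * f z := by
  induction k generalizing z with
  | zero => simp [run]
  | succ k ih =>
    have hm := measurable_natCons (X := X)
    have hg : Measurable fun ω => f (run step z ω (k + 1)) :=
      hf.comp (measurable_run hstep z (k + 1))
    have hz : Measurable (step z) := hstep.comp measurable_prodMk_left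
    calc ∫⁻ ω, f (run step z ω (k + 1)) ∂(Measure.infinitePi fun _ : ℕ => ν)
        = ∫⁻ x, ∫⁻ ω, f (run step (step z x) ω k) ∂(Measure.infinitePi fun _ : ℕ => ν) ∂ν := by
          conv_lhs => rw [← map_natCons_infinitePi ν]
          rw [lintegral_map hg hm]
          refine (lintegral_prod _ (hg.comp hm).aemeasurable).trans ?_
          simp only [Function.comp_def, run_succ']
          rfl
      _ ≤ ∫⁻ x, a ^ k * f (step z x) ∂ν := lintegral_mono fun x => ih _
      _ = a ^ k * ∫⁻ x, f (step z x) ∂ν := lintegral_const_mul _ (hf.comp hz)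
      _ ≤ a ^ k * (a * f z) := by gcongr; exact h z
      _ = a ^ (k + 1) * f z := by rw [pow_succ, mul_assoc]

end Iteration

/-! ### An exponential moment of the exponential law -/

/-- The exponential moment of order `r / 2` of the exponential law of rate `r`: tilting the density
by `exp (r / 2 * x)` gives twice the density of the exponential law of rate `r / 2`. -/
theorem lintegral_exp_half_expMeasure {r : ℝ} (hr : 0 < r) :
    ∫⁻ x, ENNReal.ofReal (Real.exp (r / 2 * x)) ∂(expMeasure r) = 2 := by
  have h1 : expMeasure r = volume.withDensity (exponentialPDF r) := rfl
  have hm : Measurable (exponentialPDF r) := (measurable_exponentialPDFReal r).ennreal_ofReal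
  have hm' : Measurable (exponentialPDF (r / 2)) :=
    (measurable_exponentialPDFReal (r / 2)).ennreal_ofReal
  rw [h1, lintegral_withDensity_eq_lintegral_mul _ hm (by fun_prop)]
  have h2 : ∀ x, (exponentialPDF r * fun x => ENNReal.ofReal (Real.exp (r / 2 * x))) x =
      2 * exponentialPDF (r / 2) x := by
    intro x
    rw [Pi.mul_apply]
    rcases lt_or_ge x 0 with hx | hx
    · rw [exponentialPDF_of_neg hx, exponentialPDF_of_neg hx, zero_mul, mul_zero]
    · rw [exponentialPDF_of_nonneg hx, exponentialPDF_of_nonneg hx,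
        ← ENNReal.ofReal_mul (by positivity), mul_assoc, ← Real.exp_add,
        ← ENNReal.ofReal_ofNat 2, ← ENNReal.ofReal_mul (by norm_num)]
      congr 1
      rw [show -(r * x) + r / 2 * x = -(r / 2 * x) by ring]
      ring
  simp_rw [h2]
  rw [lintegral_const_mul _ hm', lintegral_exponentialPDF_eq_one (by positivity), mul_one]

variable {n : ℕ}

/-! ### The flow into a set of nodes -/

/-- The expected number of nodes outside `A` that contact a node of `A`, if every node initiates one
communication. -/
noncomputable def pullFlow (P : Matrix (Fin n) (Fin n) ℝ) (A : Finset (Fin n)) : ℝ :=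
  ∑ j ∈ Aᶜ, ∑ i ∈ A, P j i

/-- For a doubly stochastic matrix, the flow into a set of nodes equals the flow out of it. -/
theorem pullFlow_compl {P : Matrix (Fin n) (Fin n) ℝ} (hP : P ∈ doublyStochastic ℝ (Fin n))
    (A : Finset (Fin n)) : pullFlow P Aᶜ = pullFlow P A := by
  have h1 : ∑ i ∈ A, ∑ j, P i j = ∑ i ∈ A, ∑ j, P j i :=
    Finset.sum_congr rfl fun i _ => by
      rw [sum_row_of_mem_doublyStochastic hP, sum_col_of_mem_doublyStochastic hP]
  have h2 : ∀ f : Fin n → ℝ, ∑ j, f j = ∑ j ∈ A, f j + ∑ j ∈ Aᶜ, f j :=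
    fun f => (Finset.sum_add_sum_compl A f).symm
  simp only [h2, Finset.sum_add_distrib] at h1
  rw [Finset.sum_comm (s := A) (t := A) (f := fun i j => P j i)] at h1
  unfold pullFlow
  rw [compl_compl]
  linarith [Finset.sum_comm (s := A) (t := Aᶜ) (f := fun i j => P j i)]

theorem pullFlow_nonneg {P : Matrix (Fin n) (Fin n) ℝ} (hP : P ∈ doublyStochastic ℝ (Fin n))
    (A : Finset (Fin n)) : 0 ≤ pullFlow P A :=
  Finset.sum_nonneg fun _ _ => Finset.sum_nonneg fun _ _ => nonneg_of_mem_doublyStochastic hP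

theorem pullFlow_le_card_compl {P : Matrix (Fin n) (Fin n) ℝ}
    (hP : P ∈ doublyStochastic ℝ (Fin n)) (A : Finset (Fin n)) : pullFlow P A ≤ Aᶜ.card := by
  have h : ∀ j ∈ Aᶜ, ∑ i ∈ A, P j i ≤ 1 := fun j _ => by
    rw [← sum_row_of_mem_doublyStochastic hP j]
    exact Finset.sum_le_univ_sum_of_nonneg fun i => nonneg_of_mem_doublyStochastic hP
  simpa [pullFlow] using Finset.sum_le_sum h

/-- The conductance bounds the flow out of a small set from below. -/
theorem conductance_mul_card_le {P : Matrix (Fin n) (Fin n) ℝ}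
    (hP : P ∈ doublyStochastic ℝ (Fin n)) {S : Finset (Fin n)} (h0 : 0 < S.card)
    (h1 : 2 * S.card ≤ n) : (conductance P).toReal * S.card ≤ pullFlow P Sᶜ := by
  have h : conductance P ≤ ENNReal.ofReal (pullFlow P Sᶜ / S.card) := by
    refine (iInf₂_le S ⟨h0, h1⟩).trans_eq ?_
    rw [pullFlow, compl_compl]
  have h2 := ENNReal.toReal_mono ENNReal.ofReal_ne_top h
  rw [ENNReal.toReal_ofReal (div_nonneg (pullFlow_nonneg hP _) (Nat.cast_nonneg _)),
    le_div_iff₀ (by exact_mod_cast h0)] at h2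
  exact h2

theorem card_add_card_compl_fin (A : Finset (Fin n)) : A.card + Aᶜ.card = n := by
  simp

/-- The flow into a set is at least the conductance times the size of the smaller side. -/
theorem conductance_mul_min_le {P : Matrix (Fin n) (Fin n) ℝ}
    (hP : P ∈ doublyStochastic ℝ (Fin n)) {A : Finset (Fin n)} (hA : A.Nonempty)
    (hA' : Aᶜ.Nonempty) :
    (conductance P).toReal * min (A.card : ℝ) (n - A.card) ≤ pullFlow P A := by
  have hc := card_add_card_compl_fin A
  have hcR : (A.card : ℝ) + Aᶜ.card = n := mod_cast hc
  have hc' : (n : ℝ) - A.card = Aᶜ.card := by linarith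
  rw [hc']
  rcases le_total A.card Aᶜ.card with h | h
  · rw [min_eq_left (by exact_mod_cast h), ← pullFlow_compl hP]
    exact conductance_mul_card_le hP hA.card_pos (by omega)
  · rw [min_eq_right (by exact_mod_cast h)]
    simpa using conductance_mul_card_le hP hA'.card_pos (by omega)

theorem conductance_le_one {P : Matrix (Fin n) (Fin n) ℝ} (hP : P ∈ doublyStochastic ℝ (Fin n))
    (hn : 2 ≤ n) : conductance P ≤ 1 := by
  have h : conductance P ≤ ENNReal.ofReal (pullFlow P {⟨0, by omega⟩}ᶜ / 1) := by
    refine (iInf₂_le {⟨0, by omega⟩} ⟨by simp, by simpa using hn⟩).trans_eq ?_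
    simp [pullFlow]
  refine h.trans (ENNReal.ofReal_le_one.2 ?_)
  rw [div_one]
  simpa using pullFlow_le_card_compl hP {⟨0, by omega⟩}ᶜ

/-! ### The potential of a set of informed nodes -/

/-- The ratio of the numbers of uninformed and informed nodes, where `A` is the set of informed
nodes. It is `0` if all nodes are informed, and `∞` if none is. -/
noncomputable def potential (A : Set (Fin n)) : ℝ≥0∞ := (Aᶜ.ncard : ℝ≥0∞) / A.ncard

theorem potential_anti {A B : Set (Fin n)} (h : A ⊆ B) : potential B ≤ potential A := by
  unfold potential
  gcongr
  · exact Set.toFinite _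
  · exact Set.toFinite _

theorem potential_coe {A : Finset (Fin n)} (hA : A.Nonempty) :
    potential (A : Set (Fin n)) = ENNReal.ofReal (n / A.card - 1) := by
  have hc := card_add_card_compl_fin A
  have hpos : (0 : ℝ) < A.card := by exact_mod_cast hA.card_pos
  have hcR : (A.card : ℝ) + Aᶜ.card = n := mod_cast hc
  have : (n : ℝ) / A.card - 1 = Aᶜ.card / A.card := by
    field_simp
    linarith
  rw [this, ENNReal.ofReal_div_of_pos hpos, ENNReal.ofReal_natCast, ENNReal.ofReal_natCast,
    potential, ← Finset.coe_compl, Set.ncard_coe_finset, Set.ncard_coe_finset]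

theorem potential_singleton_le (v : Fin n) : potential {v} ≤ n := by
  rw [potential, Set.ncard_singleton, Nat.cast_one, div_one]
  have := Set.ncard_le_card (({v} : Set (Fin n))ᶜ)
  simp only [Nat.card_eq_fintype_card, Fintype.card_fin] at this
  exact_mod_cast this

theorem inv_le_potential {A : Set (Fin n)} (h : A ≠ Set.univ) : (n : ℝ≥0∞)⁻¹ ≤ potential A := by
  have h1 : 1 ≤ Aᶜ.ncard := by
    rw [Nat.one_le_iff_ne_zero, Ne, Set.ncard_eq_zero (Set.toFinite _), Set.compl_empty_iff]
    exact h
  have h2 : A.ncard ≤ n := by simpa using Set.ncard_le_card A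
  rw [potential, ← one_div]
  gcongr
  exact_mod_cast h1

theorem potential_empty [NeZero n] : potential (∅ : Set (Fin n)) = ∞ := by
  simp [potential, Set.ncard_univ, ENNReal.div_zero, NeZero.ne n]

/-! ### One time slot of the synchronous model -/

/-- If `X ≥ 0` has mean `m` and `𝔼 X ^ 2 ≤ m + m ^ 2`, then in expectation, replacing `s` by `s + X`
lowers `N / s` by at least the proportion `m / (s + 1 + m)`. -/
theorem integral_div_add_le {Ω : Type*} [MeasurableSpace Ω] [Finite Ω]
    [MeasurableSingletonClass Ω] (μ : Measure Ω) [IsProbabilityMeasure μ] {X : Ω → ℝ} {N s m : ℝ}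
    (hN : 0 ≤ N) (hs : 0 < s) (hm : 0 ≤ m) (hX : ∀ ω, 0 ≤ X ω) (h1 : ∫ ω, X ω ∂μ = m)
    (h2 : ∫ ω, X ω ^ 2 ∂μ ≤ m + m ^ 2) :
    ∫ ω, (N / (s + X ω) - 1) ∂μ ≤ N / s * (1 - m / (s + 1 + m)) - 1 := by
  have hd : 0 < s + 1 + m := by linarith
  set l := (s + 1 + m)⁻¹ with hl
  have hl0 : 0 < l := by positivity
  -- The tangent of `1 / y` at `y = 1 / l` gives `1 / y ≥ 2 * l - l ^ 2 * y`; multiply this by `X`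
  -- at `y = s + X`. The choice of `l` is the optimal one for the moment bounds at hand.
  have key : ∀ ω, N / (s + X ω) - 1 ≤
      N / s * (1 - (2 * l * X ω - l ^ 2 * (s * X ω + X ω ^ 2))) - 1 := by
    intro ω
    have hx := hX ω
    have hy : 0 < s + X ω := by linarith
    have h3 : 2 * l * X ω - l ^ 2 * (s * X ω + X ω ^ 2) ≤ X ω / (s + X ω) := by
      rw [le_div_iff₀ hy]
      nlinarith [mul_nonneg hx (sq_nonneg (1 - l * (s + X ω)))]
    have h4 : N / (s + X ω) = N / s * (1 - X ω / (s + X ω)) := by field_simp; ring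
    rw [h4]
    gcongr
  calc ∫ ω, (N / (s + X ω) - 1) ∂μ
      ≤ ∫ ω, (N / s * (1 - (2 * l * X ω - l ^ 2 * (s * X ω + X ω ^ 2))) - 1) ∂μ :=
        integral_mono .of_finite .of_finite key
    _ = N / s * (1 - (2 * l * m - l ^ 2 * (s * m + ∫ ω, X ω ^ 2 ∂μ))) - 1 := by
        rw [integral_sub .of_finite .of_finite, integral_const_mul,
          integral_sub .of_finite .of_finite, integral_sub .of_finite .of_finite,
          integral_const_mul, integral_const_mul, integral_add .of_finite .of_finite,
          integral_const_mul, h1]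
        simp
    _ ≤ N / s * (1 - m / (s + 1 + m)) - 1 := by
        have h5 : l ^ 2 * (s * m + ∫ ω, X ω ^ 2 ∂μ) ≤ l * m := by
          calc l ^ 2 * (s * m + ∫ ω, X ω ^ 2 ∂μ) ≤ l ^ 2 * (s * m + (m + m ^ 2)) := by gcongr
            _ = l * m * (l * (s + 1 + m)) := by ring
            _ = l * m := by rw [hl, inv_mul_cancel₀ hd.ne', mul_one]
        have h6 : m / (s + 1 + m) = l * m := by rw [hl]; field_simp
        rw [h6]
        gcongr
        linarith

theorem integral_contactPMF (P : Matrix (Fin n) (Fin n) ℝ)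
    (hP : P ∈ Matrix.rowStochastic ℝ (Fin n)) (i : Fin n) (f : Fin n → ℝ) :
    ∫ j, f j ∂(contactPMF P hP i).toMeasure = ∑ j, P i j * f j := by
  rw [PMF.integral_eq_sum]
  refine Finset.sum_congr rfl fun j _ => ?_
  rw [contactPMF, PMF.ofFintype_apply, smul_eq_mul,
    ENNReal.toReal_ofReal (Matrix.nonneg_of_mem_rowStochastic hP)]

/-- The law of the contacts of all nodes in one time slot. -/
noncomputable def slotLaw (P : Matrix (Fin n) (Fin n) ℝ)
    (hP : P ∈ Matrix.rowStochastic ℝ (Fin n)) : Measure (Fin n → Fin n) :=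
  Measure.pi fun i => (contactPMF P hP i).toMeasure

instance (P : Matrix (Fin n) (Fin n) ℝ) (hP : P ∈ Matrix.rowStochastic ℝ (Fin n)) :
    IsProbabilityMeasure (slotLaw P hP) := by
  unfold slotLaw; infer_instance

/-- The nodes outside `A` that contact a node of `A`. -/
def pulled (A : Finset (Fin n)) (c : Fin n → Fin n) : Finset (Fin n) :=
  Finset.univ.filter fun j => j ∉ A ∧ c j ∈ A

theorem card_pulled_eq_sum (A : Finset (Fin n)) (c : Fin n → Fin n) :
    ((pulled A c).card : ℝ) = ∑ j, if j ∉ A ∧ c j ∈ A then 1 else 0 := by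
  rw [pulled, Finset.sum_boole]

theorem integral_pulled_indicator (P : Matrix (Fin n) (Fin n) ℝ)
    (hP : P ∈ Matrix.rowStochastic ℝ (Fin n)) (A : Finset (Fin n)) (j : Fin n) :
    ∫ c, (if j ∉ A ∧ c ∈ A then 1 else 0 : ℝ) ∂(contactPMF P hP j).toMeasure =
      if j ∈ Aᶜ then ∑ i ∈ A, P j i else 0 := by
  rw [integral_contactPMF]
  by_cases h : j ∈ A
  · simp [h]
  · simp [h, Finset.sum_ite_mem]

theorem integral_card_pulled (P : Matrix (Fin n) (Fin n) ℝ)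
    (hP : P ∈ Matrix.rowStochastic ℝ (Fin n)) (A : Finset (Fin n)) :
    ∫ c, ((pulled A c).card : ℝ) ∂slotLaw P hP = pullFlow P A := by
  simp_rw [card_pulled_eq_sum]
  rw [integral_finsetSum _ fun _ _ => .of_finite, pullFlow, ← Finset.univ_inter Aᶜ,
    ← Finset.sum_ite_mem]
  refine Finset.sum_congr rfl fun j _ => ?_
  rw [← integral_pulled_indicator P hP A j]
  have h := (measurePreserving_eval (fun i => (contactPMF P hP i).toMeasure) j).map_eq
  rw [← h, integral_map (measurable_pi_apply j).aemeasurable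
    (measurable_of_finite _).aestronglyMeasurable]
  rfl

/-- The events that the different nodes are pulled are independent, hence the bound by the mean. -/
theorem variance_card_pulled_le (P : Matrix (Fin n) (Fin n) ℝ)
    (hP : P ∈ Matrix.rowStochastic ℝ (Fin n)) (A : Finset (Fin n)) :
    variance (fun c => ((pulled A c).card : ℝ)) (slotLaw P hP) ≤ pullFlow P A := by
  -- The variance of an indicator is at most its second moment, which is its mean.
  set Y : Fin n → Fin n → ℝ := fun j c => if j ∉ A ∧ c ∈ A then 1 else 0 with hY
  have h0 : (fun c : Fin n → Fin n => ((pulled A c).card : ℝ)) =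
      ∑ j, fun c : Fin n → Fin n => Y j (c j) := by
    ext c
    rw [card_pulled_eq_sum, Finset.sum_apply]
  have hL : ∀ j, MemLp (Y j) 2 (contactPMF P hP j).toMeasure := fun j => .of_discrete
  rw [h0, slotLaw, variance_sum_pi hL, pullFlow, ← Finset.univ_inter Aᶜ, ← Finset.sum_ite_mem]
  refine Finset.sum_le_sum fun j _ => ?_
  rw [← integral_pulled_indicator P hP A j]
  refine (variance_le_expectation_sq (hL j).aestronglyMeasurable).trans_eq ?_
  refine integral_congr_ae (.of_forall fun c => ?_)
  simp only [hY, Pi.pow_apply]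
  split_ifs <;> norm_num

theorem card_union_pulled (A : Finset (Fin n)) (c : Fin n → Fin n) :
    (A ∪ pulled A c).card = A.card + (pulled A c).card :=
  Finset.card_union_of_disjoint (Finset.disjoint_left.2 fun j hj hj' => by simp_all [pulled])

/-- In one time slot, the nodes that pull decrease the potential by the factor `1 - φ / 3` in
expectation, where `φ` bounds the expansion from below. -/
theorem lintegral_potential_pulled_le {P : Matrix (Fin n) (Fin n) ℝ}
    (hP : P ∈ doublyStochastic ℝ (Fin n)) {φ : ℝ} (hφ0 : 0 ≤ φ) (hφ1 : φ ≤ 1) {A : Finset (Fin n)}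
    (hA : A.Nonempty) (hA' : Aᶜ.Nonempty) (hφ : φ * min (A.card : ℝ) (n - A.card) ≤ pullFlow P A) :
    ∫⁻ c, potential ((A ∪ pulled A c : Finset (Fin n)) : Set (Fin n))
        ∂slotLaw P (rowStochastic_of_doubly hP) ≤
      ENNReal.ofReal (1 - φ / 3) * potential (A : Set (Fin n)) := by
  set m := pullFlow P A with hm
  have hm0 : 0 ≤ m := pullFlow_nonneg hP A
  have hs : (1 : ℝ) ≤ A.card := by exact_mod_cast hA.card_pos
  have hc := card_add_card_compl_fin A
  have hcR : (A.card : ℝ) + Aᶜ.card = n := mod_cast hc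
  have hs' : (1 : ℝ) ≤ Aᶜ.card := by exact_mod_cast hA'.card_pos
  have hmn : m ≤ n - A.card := (pullFlow_le_card_compl hP A).trans_eq (by linarith)
  have h2 := variance_card_pulled_le P (rowStochastic_of_doubly hP) A
  rw [variance_eq_sub .of_discrete, integral_card_pulled] at h2
  have h3 := integral_div_add_le (slotLaw P (rowStochastic_of_doubly hP))
    (X := fun c => ((pulled A c).card : ℝ)) (N := n) (s := A.card) (m := m) (Nat.cast_nonneg n)
    (by linarith) hm0 (fun c => Nat.cast_nonneg _) (integral_card_pulled _ _ _)
    (by simp only [Pi.pow_apply] at h2; linarith)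
  have hle : ∀ c, ((A ∪ pulled A c).card : ℝ) ≤ n := fun c => by
    exact_mod_cast (Finset.card_le_univ (A ∪ pulled A c)).trans_eq (Fintype.card_fin n)
  simp_rw [potential_coe hA, fun c => potential_coe (hA.mono (Finset.subset_union_left
    (s₂ := pulled A c)))]
  simp only [card_union_pulled, Nat.cast_add] at hle ⊢
  rw [← ofReal_integral_eq_lintegral_ofReal .of_finite, ← ENNReal.ofReal_mul (by linarith)]
  · refine ENNReal.ofReal_le_ofReal (h3.trans ?_)
    generalize (A.card : ℝ) = s at *
    generalize (Aᶜ.card : ℝ) = s' at *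
    generalize (n : ℝ) = N at *
    have hd : 0 < s + 1 + m := by linarith
    have hspos : 0 < s := by linarith
    -- The claim without denominators; the two cases are those of the smaller side.
    have key : φ * (N - s) * (s + 1 + m) ≤ 3 * N * m := by
      have h4 : 2 * N ≤ 3 * N - φ * (N - s) := by nlinarith
      have h5 : φ * (N - s) * (s + 1) ≤ m * (2 * N) := by
        rcases min_choice s (N - s) with h | h
        · rw [h] at hφ
          calc φ * (N - s) * (s + 1) ≤ φ * s * (2 * N) := by
                have : (N - s) * (s + 1) ≤ s * (2 * N) := by nlinarith
                nlinarith
            _ ≤ m * (2 * N) := by gcongr; linarith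
        · rw [h] at hφ
          have : 0 ≤ N - s := by linarith
          gcongr
          linarith
      nlinarith
    have h6 : φ / 3 * (N / s - 1) ≤ N / s * (m / (s + 1 + m)) := by
      rw [div_mul_div_comm, le_div_iff₀ (by positivity)]
      have : φ / 3 * (N / s - 1) * (s * (s + 1 + m)) = φ * (N - s) * (s + 1 + m) / 3 := by
        field_simp
      rw [this]
      linarith
    linarith
  · refine .of_forall fun c => ?_
    have := hle c
    have h7 : (0 : ℝ) < A.card + (pulled A c).card := by positivity
    simp only [Pi.zero_apply, sub_nonneg]
    rwa [one_le_div h7]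

/-! ### One tick of the asynchronous model -/

theorem integral_tickPMF [NeZero n] (P : Matrix (Fin n) (Fin n) ℝ)
    (hP : P ∈ Matrix.rowStochastic ℝ (Fin n)) (f : Fin n × Fin n → ℝ) :
    ∫ x, f x ∂(tickPMF P hP).toMeasure = (n : ℝ)⁻¹ * ∑ i, ∑ j, P i j * f (i, j) := by
  have h : ∀ i j, (tickPMF P hP (i, j)).toReal = (n : ℝ)⁻¹ * P i j := by
    intro i j
    have h1 : tickPMF P hP (i, j) = (n : ℝ≥0∞)⁻¹ * ENNReal.ofReal (P i j) := by
      classical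
      rw [tickPMF, PMF.bind_apply, tsum_fintype, Finset.sum_eq_single i]
      · rw [PMF.uniformOfFintype_apply, Fintype.card_fin, PMF.map_apply, tsum_fintype,
          Finset.sum_eq_single j]
        · simp [contactPMF]
        · intro b _ hb
          simp [Ne.symm hb]
        · simp
      · intro b _ hb
        simp [PMF.map_apply, Ne.symm hb]
      · simp
    rw [h1, ENNReal.toReal_mul, ENNReal.toReal_inv, ENNReal.toReal_natCast,
      ENNReal.toReal_ofReal (Matrix.nonneg_of_mem_rowStochastic hP)]
  rw [PMF.integral_eq_sum, Fintype.sum_prod_type, Finset.mul_sum]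
  refine Finset.sum_congr rfl fun i _ => ?_
  rw [Finset.mul_sum]
  refine Finset.sum_congr rfl fun j _ => ?_
  rw [h, smul_eq_mul, mul_assoc]

/-- The nodes informed after one tick, if `A` is the set of informed nodes before it and the
initiator `x.1` pulls from the contacted node `x.2`. -/
def pullTick (A : Finset (Fin n)) (x : Fin n × Fin n) : Finset (Fin n) :=
  if x.1 ∉ A ∧ x.2 ∈ A then insert x.1 A else A

/-- In one tick, a pull by the initiator decreases the potential by the factor `1 - φ / (2 * n)` in
expectation, where `φ` bounds the expansion from below. -/
theorem lintegral_potential_pullTick_le [NeZero n] {P : Matrix (Fin n) (Fin n) ℝ}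
    (hP : P ∈ doublyStochastic ℝ (Fin n)) {φ : ℝ} (hφ0 : 0 ≤ φ) (hφ1 : φ ≤ 1) {A : Finset (Fin n)}
    (hA : A.Nonempty) (hA' : Aᶜ.Nonempty) (hφ : φ * min (A.card : ℝ) (n - A.card) ≤ pullFlow P A) :
    ∫⁻ x, potential (pullTick A x : Set (Fin n))
        ∂(tickPMF P (rowStochastic_of_doubly hP)).toMeasure ≤
      ENNReal.ofReal (1 - φ / (2 * n)) * potential (A : Set (Fin n)) := by
  set m := pullFlow P A with hm
  have hs : (1 : ℝ) ≤ A.card := by exact_mod_cast hA.card_pos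
  have hc := card_add_card_compl_fin A
  have hcR : (A.card : ℝ) + Aᶜ.card = n := mod_cast hc
  have hs' : (1 : ℝ) ≤ Aᶜ.card := by exact_mod_cast hA'.card_pos
  have hn : (0 : ℝ) < n := by linarith
  have hsub : ∀ x, A ⊆ pullTick A x := fun x => by
    unfold pullTick
    split_ifs
    · exact Finset.subset_insert _ _
    · exact subset_rfl
  have hval : ∀ x : Fin n × Fin n, (n : ℝ) / (pullTick A x).card - 1 =
      (n / A.card - 1) - n / (A.card * (A.card + 1)) * if x.1 ∉ A ∧ x.2 ∈ A then 1 else 0 := by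
    intro x
    by_cases h : x.1 ∉ A ∧ x.2 ∈ A
    · rw [pullTick, if_pos h, if_pos h, Finset.card_insert_of_notMem h.1]
      push_cast
      field_simp
      ring
    · rw [pullTick, if_neg h, if_neg h]
      ring
  have hint : ∫ x : Fin n × Fin n, (if x.1 ∉ A ∧ x.2 ∈ A then 1 else 0 : ℝ)
      ∂(tickPMF P (rowStochastic_of_doubly hP)).toMeasure = (n : ℝ)⁻¹ * m := by
    rw [integral_tickPMF, hm, pullFlow, ← Finset.univ_inter Aᶜ, ← Finset.sum_ite_mem]
    congr 1
    refine Finset.sum_congr rfl fun j _ => ?_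
    by_cases h : j ∈ A
    · simp [h]
    · simp [h, Finset.sum_ite_mem]
  simp_rw [potential_coe hA, fun x => potential_coe (hA.mono (hsub x))]
  rw [← ofReal_integral_eq_lintegral_ofReal .of_finite, ← ENNReal.ofReal_mul]
  · refine ENNReal.ofReal_le_ofReal ?_
    simp_rw [hval]
    rw [integral_sub .of_finite .of_finite, integral_const_mul, hint]
    simp only [integral_const, probReal_univ, one_smul]
    generalize (A.card : ℝ) = s at *
    generalize (Aᶜ.card : ℝ) = s' at *
    generalize (n : ℝ) = N at *
    have hspos : 0 < s := by linarith
    -- The claim without denominators; the two cases are those of the smaller side.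
    have key : φ * (N - s) * (s + 1) ≤ 2 * N * m := by
      rcases min_choice s (N - s) with h | h
      · rw [h] at hφ
        have : (N - s) * (s + 1) ≤ s * (2 * N) := by nlinarith
        nlinarith
      · rw [h] at hφ
        have h1 : φ * (N - s) * (s + 1) ≤ φ * (N - s) * (2 * N) := by
          have : 0 ≤ φ * (N - s) := mul_nonneg hφ0 (by linarith)
          gcongr
          linarith
        nlinarith
    have h6 : φ / (2 * N) * (N / s - 1) ≤ N / (s * (s + 1)) * (N⁻¹ * m) := by
      have e1 : φ / (2 * N) * (N / s - 1) = φ * (N - s) * (s + 1) / (2 * N * (s * (s + 1))) := by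
        field_simp
      have e2 : N / (s * (s + 1)) * (N⁻¹ * m) = 2 * N * m / (2 * N * (s * (s + 1))) := by
        field_simp
      rw [e1, e2]
      gcongr
    linarith
  · have : φ / (2 * n) ≤ 1 := by
      rw [div_le_one (by positivity)]
      linarith
    linarith
  · refine .of_forall fun x => ?_
    have h8 : ((pullTick A x).card : ℝ) ≤ n := by
      exact_mod_cast (Finset.card_le_univ (pullTick A x)).trans_eq (Fintype.card_fin n)
    have h7 : (0 : ℝ) < (pullTick A x).card := by
      exact_mod_cast (hA.mono (hsub x)).card_pos
    simp only [Pi.zero_apply, sub_nonneg]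
    rwa [one_le_div h7]

/-! ### The probability that some message has not reached all nodes -/

/-- Markov's inequality for the potential and the union bound over the messages. -/
theorem measure_exists_ne_univ_le [NeZero n] {Ω : Type*} [MeasurableSpace Ω] {μ : Measure Ω}
    {H : Ω → Fin n → Set (Fin n)} {b : ℝ≥0∞} (hm : ∀ v, Measurable fun ω => potential (H ω v))
    (hb : ∀ v, ∫⁻ ω, potential (H ω v) ∂μ ≤ b * n) :
    μ {ω | ∃ v, H ω v ≠ Set.univ} ≤ (n : ℝ≥0∞) ^ 3 * b := by
  have hn0 : (n : ℝ≥0∞) ≠ 0 := by exact_mod_cast NeZero.ne n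
  have h1 : ∀ v, μ {ω | H ω v ≠ Set.univ} ≤ n * (b * n) := by
    intro v
    have h2 := (mul_meas_ge_le_lintegral (μ := μ) (hm v) (n : ℝ≥0∞)⁻¹).trans (hb v)
    rw [mul_comm, ← div_eq_mul_inv, ENNReal.div_le_iff hn0 (ENNReal.natCast_ne_top n)] at h2
    calc μ {ω | H ω v ≠ Set.univ} ≤ μ {ω | (n : ℝ≥0∞)⁻¹ ≤ potential (H ω v)} :=
          measure_mono fun ω hω => inv_le_potential hω
      _ ≤ b * n * n := h2
      _ = n * (b * n) := mul_comm _ _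
  calc μ {ω | ∃ v, H ω v ≠ Set.univ} = μ (⋃ v, {ω | H ω v ≠ Set.univ}) := by
        rw [Set.ofPred_exists]
    _ ≤ ∑ v, μ {ω | H ω v ≠ Set.univ} := measure_iUnion_fintype_le _ _
    _ ≤ ∑ _v : Fin n, n * (b * n) := Finset.sum_le_sum fun v _ => h1 v
    _ = (n : ℝ≥0∞) ^ 3 * b := by
        rw [Finset.sum_const, Finset.card_univ, Fintype.card_fin, nsmul_eq_mul]
        ring

theorem cube_mul_one_sub_pow_le [NeZero n] {x η : ℝ} (hη : 0 < η) {K : ℕ}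
    (hx1 : x ≤ 1) (h : 3 * Real.log n + Real.log η⁻¹ ≤ K * x) :
    (n : ℝ≥0∞) ^ 3 * ENNReal.ofReal (1 - x) ^ K ≤ ENNReal.ofReal η := by
  have hn : (0 : ℝ) < n := by exact_mod_cast NeZero.pos n
  rw [← ENNReal.ofReal_pow (by linarith), ← ENNReal.ofReal_natCast n,
    ← ENNReal.ofReal_pow hn.le, ← ENNReal.ofReal_mul (by positivity)]
  refine ENNReal.ofReal_le_ofReal ?_
  calc (n : ℝ) ^ 3 * (1 - x) ^ K ≤ (n : ℝ) ^ 3 * Real.exp (-x) ^ K := by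
        gcongr
        exact Real.one_sub_le_exp_neg x
    _ = Real.exp (3 * Real.log n + K * -x) := by
        rw [Real.exp_add, ← Real.exp_nat_mul]
        congr 1
        rw [← Real.exp_log hn, Real.log_exp, ← Real.exp_nat_mul]
        norm_num
    _ ≤ Real.exp (Real.log η) := by
        rw [Real.log_inv] at h
        gcongr
        linarith
    _ = η := Real.exp_log hη

theorem spreadingTime_le {Ω : Type*} [MeasurableSpace Ω] {μ : Measure Ω}
    {S : ℝ≥0 → Ω → Fin n → Set (Fin n)} {δ : ℝ} {t : ℝ≥0}
    (h : μ {ω | ∃ v, S t ω v ≠ Set.univ} ≤ ENNReal.ofReal δ) : spreadingTime μ S δ ≤ t :=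
  iInf₂_le t h

theorem holders_initialState (v : Fin n) : holders initialState v = {v} := by
  ext j
  simp [holders, initialState, eq_comm]

theorem potential_holders_initialState_le (v : Fin n) :
    potential (holders initialState v) ≤ n := by
  rw [holders_initialState]
  exact potential_singleton_le v

theorem measurable_potential_holders (v : Fin n) :
    Measurable fun M : State n => potential (holders M v) :=
  measurable_of_countable _

/-! ### The synchronous spreading time -/

theorem syncState_eq_run (c : ℕ → Fin n → Fin n) (t : ℕ) :
    syncState c t = run exchangeAll initialState c t := by
  induction t with
  | zero => rfl
  | succ t ih => rw [syncState, run, ih]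

theorem union_pulled_subset_holders {M : State n} {v : Fin n} {A : Finset (Fin n)}
    (hA : (A : Set (Fin n)) = holders M v) (c : Fin n → Fin n) :
    ((A ∪ pulled A c : Finset (Fin n)) : Set (Fin n)) ⊆ holders (exchangeAll M c) v := by
  have hA' : ∀ j, j ∈ A ↔ v ∈ M j := fun j => by
    rw [← Finset.mem_coe, hA]; rfl
  intro j hj
  simp only [Finset.coe_union, Set.mem_union, Finset.mem_coe, pulled, Finset.mem_filter, hA'] at hj
  rcases hj with hj | hj
  · exact Or.inl (Or.inl hj)
  · exact Or.inl (Or.inr hj.2.2)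

theorem lintegral_potential_exchangeAll_le [NeZero n] {P : Matrix (Fin n) (Fin n) ℝ}
    (hP : P ∈ doublyStochastic ℝ (Fin n)) (h1 : (conductance P).toReal ≤ 1) (v : Fin n)
    (M : State n) :
    ∫⁻ c, potential (holders (exchangeAll M c) v) ∂slotLaw P (rowStochastic_of_doubly hP) ≤
      ENNReal.ofReal (1 - (conductance P).toReal / 3) * potential (holders M v) := by
  obtain ⟨A, hA⟩ : ∃ A : Finset (Fin n), (A : Set (Fin n)) = holders M v :=
    (Set.toFinite _).exists_finset_coe
  rcases A.eq_empty_or_nonempty with h | hne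
  · rw [← hA, h, Finset.coe_empty, potential_empty, ENNReal.mul_top]
    · exact le_top
    · exact (ENNReal.ofReal_pos.2 (by linarith)).ne'
  have hle : ∫⁻ c, potential (holders (exchangeAll M c) v)
      ∂slotLaw P (rowStochastic_of_doubly hP) ≤
      ∫⁻ c, potential ((A ∪ pulled A c : Finset (Fin n)) : Set (Fin n))
        ∂slotLaw P (rowStochastic_of_doubly hP) :=
    lintegral_mono fun c => potential_anti (union_pulled_subset_holders hA c)
  refine hle.trans ?_
  rw [← hA]
  rcases Aᶜ.eq_empty_or_nonempty with h | hne'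
  · rw [Finset.compl_eq_empty_iff] at h
    simp [h, potential]
  · exact lintegral_potential_pulled_le hP ENNReal.toReal_nonneg h1 hne hne'
      (conductance_mul_min_le hP hne hne')

theorem syncSpreadingTime_le [NeZero n] {P : Matrix (Fin n) (Fin n) ℝ}
    (hP : P ∈ doublyStochastic ℝ (Fin n)) (h1 : (conductance P).toReal ≤ 1) {δ : ℝ} (hδ : 0 < δ)
    {K : ℕ} (hK : 3 * Real.log n + Real.log δ⁻¹ ≤ K * ((conductance P).toReal / 3)) :
    syncSpreadingTime P (rowStochastic_of_doubly hP) δ ≤ K := by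
  have hstep : Measurable (Function.uncurry (exchangeAll : State n → _ → _)) :=
    measurable_of_countable _
  have key : syncLaw P (rowStochastic_of_doubly hP) {c | ∃ v, syncSpread K c v ≠ Set.univ} ≤
      ENNReal.ofReal δ := by
    refine (measure_exists_ne_univ_le (b := ENNReal.ofReal (1 - (conductance P).toReal / 3) ^ K)
      (fun v => ?_) fun v => ?_).trans (cube_mul_one_sub_pow_le hδ (by linarith) hK)
    · simp only [syncSpread, Nat.floor_natCast, syncState_eq_run]
      exact (measurable_potential_holders v).comp (measurable_run hstep _ K)
    · simp only [syncSpread, Nat.floor_natCast, syncState_eq_run]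
      refine (lintegral_run_le (slotLaw P (rowStochastic_of_doubly hP)) hstep
        (measurable_potential_holders v) (lintegral_potential_exchangeAll_le hP h1 v)
        initialState K).trans ?_
      gcongr
      exact potential_holders_initialState_le v
  simpa [syncSpreadingTime] using spreadingTime_le key

/-! ### The asynchronous spreading time -/

theorem tickState_eq_run (ω : ℕ → ℝ × (Fin n × Fin n)) (k : ℕ) :
    tickState ω k = run (fun M x => exchange M x.2.1 x.2.2) initialState ω k := by
  induction k with
  | zero => rfl
  | succ k ih => rw [tickState, run, ih]

theorem tickTime_eq_run (ω : ℕ → ℝ × (Fin n × Fin n)) (k : ℕ) :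
    tickTime ω k = run (fun τ x => τ + x.1) 0 ω k := by
  induction k with
  | zero => simp [tickTime, run]
  | succ k ih => rw [run, ← ih, tickTime, tickTime, Finset.sum_range_succ]

theorem pullTick_subset_holders {M : State n} {v : Fin n} {A : Finset (Fin n)}
    (hA : (A : Set (Fin n)) = holders M v) (x : Fin n × Fin n) :
    (pullTick A x : Set (Fin n)) ⊆ holders (exchange M x.1 x.2) v := by
  have hA' : ∀ j, j ∈ A ↔ v ∈ M j := fun j => by
    rw [← Finset.mem_coe, hA]; rfl
  intro j hj
  simp only [pullTick, Finset.mem_coe] at hj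
  simp only [holders, exchange, Set.mem_ofPred_eq]
  split_ifs at hj with h <;> split_ifs with h' <;> simp_all
  grind

theorem lintegral_potential_exchange_le [NeZero n] {P : Matrix (Fin n) (Fin n) ℝ}
    (hP : P ∈ doublyStochastic ℝ (Fin n)) (h1 : (conductance P).toReal ≤ 1) (v : Fin n)
    (M : State n) :
    ∫⁻ x, potential (holders (exchange M x.1 x.2) v)
        ∂(tickPMF P (rowStochastic_of_doubly hP)).toMeasure ≤
      ENNReal.ofReal (1 - (conductance P).toReal / (2 * n)) * potential (holders M v) := by
  have hn : (1 : ℝ) ≤ n := by exact_mod_cast NeZero.pos n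
  obtain ⟨A, hA⟩ : ∃ A : Finset (Fin n), (A : Set (Fin n)) = holders M v :=
    (Set.toFinite _).exists_finset_coe
  rcases A.eq_empty_or_nonempty with h | hne
  · rw [← hA, h, Finset.coe_empty, potential_empty, ENNReal.mul_top]
    · exact le_top
    · refine (ENNReal.ofReal_pos.2 ?_).ne'
      rw [sub_pos, div_lt_one (by positivity)]
      linarith
  have hle : ∫⁻ x, potential (holders (exchange M x.1 x.2) v)
      ∂(tickPMF P (rowStochastic_of_doubly hP)).toMeasure ≤
      ∫⁻ x, potential (pullTick A x : Set (Fin n))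
        ∂(tickPMF P (rowStochastic_of_doubly hP)).toMeasure :=
    lintegral_mono fun x => potential_anti (pullTick_subset_holders hA x)
  refine hle.trans ?_
  rw [← hA]
  rcases Aᶜ.eq_empty_or_nonempty with h | hne'
  · rw [Finset.compl_eq_empty_iff] at h
    simp [h, potential, pullTick]
  · exact lintegral_potential_pullTick_le hP ENNReal.toReal_nonneg h1 hne hne'
      (conductance_mul_min_le hP hne hne')

theorem asyncLaw_tickState_le [NeZero n] {P : Matrix (Fin n) (Fin n) ℝ}
    (hP : P ∈ doublyStochastic ℝ (Fin n)) (h1 : (conductance P).toReal ≤ 1) {η : ℝ} (hη : 0 < η)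
    {K : ℕ} (hK : 3 * Real.log n + Real.log η⁻¹ ≤ K * ((conductance P).toReal / (2 * n))) :
    asyncLaw P (rowStochastic_of_doubly hP)
      {ω | ∃ v, holders (tickState ω K) v ≠ Set.univ} ≤ ENNReal.ofReal η := by
  have hn : (1 : ℝ) ≤ n := by exact_mod_cast NeZero.pos n
  have : IsProbabilityMeasure (expMeasure (n : ℝ)) :=
    isProbabilityMeasure_expMeasure (by linarith)
  set step : State n → ℝ × (Fin n × Fin n) → State n := fun M x => exchange M x.2.1 x.2.2
    with hstep_def
  have hstep : Measurable (Function.uncurry step) :=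
    (measurable_of_countable fun p : State n × (Fin n × Fin n) => exchange p.1 p.2.1 p.2.2).comp
      (measurable_fst.prodMk (measurable_snd.comp measurable_snd))
  refine (measure_exists_ne_univ_le
    (b := ENNReal.ofReal (1 - (conductance P).toReal / (2 * n)) ^ K)
    (fun v => ?_) fun v => ?_).trans (cube_mul_one_sub_pow_le hη ?_ hK)
  · simp only [tickState_eq_run]
    exact (measurable_potential_holders v).comp (measurable_run hstep _ K)
  · simp only [tickState_eq_run]
    refine (lintegral_run_le (a := ENNReal.ofReal (1 - (conductance P).toReal / (2 * n)))
      ((expMeasure (n : ℝ)).prod (tickPMF P (rowStochastic_of_doubly hP)).toMeasure) hstep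
      (measurable_potential_holders v) (fun M => ?_) initialState K).trans ?_
    · refine (lintegral_prod _ ((measurable_potential_holders v).comp
        (hstep.comp measurable_prodMk_left)).aemeasurable).trans_le ?_
      simpa [hstep_def] using lintegral_potential_exchange_le hP h1 v M
    · gcongr
      exact potential_holders_initialState_le v
  · rw [div_le_one (by positivity)]
    linarith

/-- Chernoff's bound for the global clock: `K` ticks rarely take more than four times their expected
duration `K / n`. -/
theorem asyncLaw_tickTime_le [NeZero n] {P : Matrix (Fin n) (Fin n) ℝ}
    (hP : P ∈ Matrix.rowStochastic ℝ (Fin n)) (K : ℕ) :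
    asyncLaw P hP {ω | 4 * K / n ≤ tickTime ω K} ≤ ENNReal.ofReal (Real.exp (-K)) := by
  have hn : (0 : ℝ) < n := by exact_mod_cast NeZero.pos n
  have : IsProbabilityMeasure (expMeasure (n : ℝ)) := isProbabilityMeasure_expMeasure hn
  set f : ℝ → ℝ≥0∞ := fun τ => ENNReal.ofReal (Real.exp (n / 2 * τ)) with hf_def
  have hf : Measurable f := by fun_prop
  have hstep : Measurable (Function.uncurry fun (τ : ℝ) (x : ℝ × (Fin n × Fin n)) => τ + x.1) := by
    fun_prop
  have h1 : ∀ τ, ∫⁻ x, f (τ + x.1) ∂((expMeasure (n : ℝ)).prod (tickPMF P hP).toMeasure) ≤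
      2 * f τ := by
    intro τ
    rw [lintegral_prod _ (by fun_prop)]
    simp only [lintegral_const, measure_univ, mul_one]
    have h2 : ∀ x, f (τ + x) = f τ * f x := by
      intro x
      simp only [hf_def]
      rw [← ENNReal.ofReal_mul (Real.exp_pos _).le, ← Real.exp_add, mul_add]
    simp_rw [h2]
    rw [lintegral_const_mul _ hf, lintegral_exp_half_expMeasure hn, mul_comm]
  have h3 : ∫⁻ ω, f (tickTime ω K) ∂asyncLaw P hP ≤ 2 ^ K := by
    simp_rw [tickTime_eq_run]
    refine (lintegral_run_le _ hstep hf h1 0 K).trans_eq ?_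
    simp [hf_def]
  have hm : Measurable fun ω : ℕ → ℝ × (Fin n × Fin n) => f (tickTime ω K) := by
    simp_rw [tickTime_eq_run]
    exact hf.comp (measurable_run hstep 0 K)
  have h4 := (mul_meas_ge_le_lintegral (μ := asyncLaw P hP) hm
    (ENNReal.ofReal (Real.exp (2 * K)))).trans h3
  have h5 : {ω : ℕ → ℝ × (Fin n × Fin n) | 4 * K / n ≤ tickTime ω K} ⊆
      {ω | ENNReal.ofReal (Real.exp (2 * K)) ≤ f (tickTime ω K)} := by
    intro ω hω
    refine ENNReal.ofReal_le_ofReal (Real.exp_le_exp.2 ?_)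
    rw [Set.mem_ofPred_eq, div_le_iff₀ hn] at hω
    linarith
  refine (measure_mono h5).trans ?_
  rw [mul_comm, ← ENNReal.le_div_iff_mul_le (Or.inl (ENNReal.ofReal_pos.2 (Real.exp_pos _)).ne')
    (Or.inl ENNReal.ofReal_ne_top)] at h4
  refine h4.trans ?_
  rw [ENNReal.div_le_iff (ENNReal.ofReal_pos.2 (Real.exp_pos _)).ne' ENNReal.ofReal_ne_top,
    ← ENNReal.ofReal_mul (Real.exp_pos _).le, ← Real.exp_add, ← ENNReal.ofReal_ofNat 2,
    ← ENNReal.ofReal_pow (by norm_num)]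
  refine ENNReal.ofReal_le_ofReal ?_
  have h6 : (2 : ℝ) ≤ Real.exp 1 := by linarith [Real.add_one_le_exp (1 : ℝ)]
  calc (2 : ℝ) ^ K ≤ Real.exp 1 ^ K := by gcongr
    _ = Real.exp (-K + 2 * K) := by rw [← Real.exp_nat_mul]; congr 1; ring

theorem asyncSpreadingTime_le [NeZero n] {P : Matrix (Fin n) (Fin n) ℝ}
    (hP : P ∈ doublyStochastic ℝ (Fin n)) (h1 : (conductance P).toReal ≤ 1) {δ : ℝ} (hδ : 0 < δ)
    {K : ℕ} (hK : 3 * Real.log n + Real.log (δ / 2)⁻¹ ≤ K * ((conductance P).toReal / (2 * n)))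
    (hK' : Real.log (δ / 2)⁻¹ ≤ K) :
    asyncSpreadingTime P (rowStochastic_of_doubly hP) δ ≤ ENNReal.ofReal (4 * K / n) := by
  set t : ℝ≥0 := (4 * K / n : ℝ).toNNReal with ht
  have htR : (t : ℝ) = 4 * K / n := Real.coe_toNNReal _ (by positivity)
  refine spreadingTime_le (t := t) ?_
  have hsub : {ω : ℕ → ℝ × (Fin n × Fin n) | ∃ v, asyncSpread t ω v ≠ Set.univ} ⊆
      {ω | 4 * K / n ≤ tickTime ω K} ∪ {ω | ∃ v, holders (tickState ω K) v ≠ Set.univ} := by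
    rintro ω ⟨v, hv⟩
    by_contra hω
    simp only [Set.mem_union, Set.mem_ofPred_eq, not_or, not_le, not_exists, not_not] at hω
    refine hv (Set.eq_univ_of_forall fun j => ⟨K, ?_, ?_⟩)
    · rw [htR]
      exact hω.1.le
    · rw [hω.2 v]
      trivial
  have h2 : Real.exp (-K) ≤ δ / 2 := by
    rw [Real.log_inv] at hK'
    rw [← Real.le_log_iff_exp_le (by positivity)]
    linarith
  calc asyncLaw P (rowStochastic_of_doubly hP) {ω | ∃ v, asyncSpread t ω v ≠ Set.univ}
      ≤ _ := (measure_mono hsub).trans (measure_union_le _ _)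
    _ ≤ ENNReal.ofReal (δ / 2) + ENNReal.ofReal (δ / 2) := by
        gcongr
        · exact (asyncLaw_tickTime_le _ K).trans (ENNReal.ofReal_le_ofReal h2)
        · exact asyncLaw_tickState_le hP h1 (by positivity) hK
    _ = ENNReal.ofReal δ := by
        rw [← ENNReal.ofReal_add (by positivity) (by positivity), add_halves]

/-! ### The bound on both spreading times -/

theorem syncSpreadingTime_one (P : Matrix (Fin 1) (Fin 1) ℝ)
    (hP : P ∈ Matrix.rowStochastic ℝ (Fin 1)) (δ : ℝ) : syncSpreadingTime P hP δ = 0 := by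
  refine le_antisymm (spreadingTime_le (t := 0) ?_) zero_le
  have : {c : ℕ → Fin 1 → Fin 1 | ∃ v, syncSpread 0 c v ≠ Set.univ} = ∅ := by
    refine Set.eq_empty_of_forall_notMem fun c ⟨v, hv⟩ => hv (Set.eq_univ_of_forall fun j => ?_)
    simp [syncSpread, syncState, holders_initialState, Subsingleton.elim j v]
  rw [this, measure_empty]
  exact zero_le

theorem asyncSpreadingTime_one (P : Matrix (Fin 1) (Fin 1) ℝ)
    (hP : P ∈ Matrix.rowStochastic ℝ (Fin 1)) (δ : ℝ) : asyncSpreadingTime P hP δ = 0 := by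
  refine le_antisymm (spreadingTime_le (t := 0) ?_) zero_le
  have : {ω : ℕ → ℝ × (Fin 1 × Fin 1) | ∃ v, asyncSpread 0 ω v ≠ Set.univ} = ∅ := by
    refine Set.eq_empty_of_forall_notMem fun c ⟨v, hv⟩ => hv (Set.eq_univ_of_forall fun j => ?_)
    exact ⟨0, by simp [tickTime],
      by simp [tickState, holders_initialState, Subsingleton.elim j v]⟩
  rw [this, measure_empty]
  exact zero_le

end Gossip

theorem theorem2 :
    ∃ C : ℝ, 0 < C ∧
      ∀ (n : ℕ) [NeZero n] (G : SimpleGraph (Fin n)) (P : Matrix (Fin n) (Fin n) ℝ)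
        (hP : P ∈ doublyStochastic ℝ (Fin n))
        (_hG : ∀ i j : Fin n, i ≠ j → ¬ G.Adj i j → P i j = 0)
        (δ : ℝ) (_hδ : δ ∈ Set.Ioo (0 : ℝ) 1),
        Gossip.asyncSpreadingTime P (Gossip.rowStochastic_of_doubly hP) δ ≤
            ENNReal.ofReal (C * (Real.log n + Real.log δ⁻¹)) / Gossip.conductance P ∧
        Gossip.syncSpreadingTime P (Gossip.rowStochastic_of_doubly hP) δ ≤
            ENNReal.ofReal (C * (Real.log n + Real.log δ⁻¹)) / Gossip.conductance P := by
  refine ⟨40, by norm_num, fun n _ _ P hP _ δ ⟨hδ0, hδ1⟩ => ?_⟩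
  -- For `n = 1`, the right-hand sides are `0`, and nothing has to be spread.
  obtain rfl | hn : n = 1 ∨ 2 ≤ n := by have := NeZero.pos n; omega
  · exact ⟨(Gossip.asyncSpreadingTime_one P _ δ).trans_le zero_le,
      (Gossip.syncSpreadingTime_one P _ δ).trans_le zero_le⟩
  have hn2 : (2 : ℝ) ≤ n := by exact_mod_cast hn
  have hle := Gossip.conductance_le_one hP hn
  have hfin : Gossip.conductance P ≠ ∞ := ne_top_of_le_ne_top ENNReal.one_ne_top hle
  have hlog : (1 : ℝ) / 2 ≤ Real.log n := by
    have h2 := Real.log_two_gt_d9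
    have := Real.log_le_log (by norm_num) hn2
    linarith
  have hlog2 : Real.log 2 ≤ Real.log n := Real.log_le_log (by norm_num) hn2
  have hlogδ : 0 < Real.log δ⁻¹ := Real.log_pos ((one_lt_inv₀ hδ0).2 hδ1)
  have hlogδ2 : Real.log (δ / 2)⁻¹ = Real.log 2 + Real.log δ⁻¹ := by
    rw [inv_div, Real.log_div (by norm_num) hδ0.ne', Real.log_inv]
    ring
  set L := Real.log n + Real.log δ⁻¹ with hL
  rcases eq_or_ne (Gossip.conductance P) 0 with h0 | h0
  · rw [h0, ENNReal.div_zero (ENNReal.ofReal_pos.2 (by linarith)).ne']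
    exact ⟨le_top, le_top⟩
  set φ := (Gossip.conductance P).toReal with hφ
  have hφ0 : 0 < φ := ENNReal.toReal_pos h0 hfin
  have hφ1 : φ ≤ 1 := by simpa using ENNReal.toReal_mono ENNReal.one_ne_top hle
  -- What is left is to choose the numbers of ticks and of slots, of order `n * L / φ` and `L / φ`.
  -- Rounding them up is harmless, since `L / φ ≥ log 2 ≥ 1 / 2`.
  have hrhs : ENNReal.ofReal (40 * L) / Gossip.conductance P = ENNReal.ofReal (40 * L / φ) := by
    rw [ENNReal.ofReal_div_of_pos hφ0, hφ, ENNReal.ofReal_toReal hfin]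
  have hLφ : 1 / 2 ≤ L / φ := by
    rw [le_div_iff₀ hφ0]
    linarith
  have hLL : L ≤ L / φ := le_div_self (by linarith) hφ0 hφ1
  rw [hrhs]
  constructor
  · have hK := Nat.le_ceil (8 * n * (L / φ))
    have hK2 := (Nat.ceil_lt_add_one (show 0 ≤ 8 * n * (L / φ) by positivity)).le
    set K := ⌈8 * n * (L / φ)⌉₊
    have hK3 : 8 * n * L ≤ K * φ := by
      have := mul_le_mul_of_nonneg_right hK hφ0.le
      rwa [mul_assoc, div_mul_cancel₀ _ hφ0.ne'] at this
    refine (Gossip.asyncSpreadingTime_le (K := K) hP hφ1 hδ0 ?_ ?_).trans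
      (ENNReal.ofReal_le_ofReal ?_)
    · rw [hlogδ2, ← hφ, ← mul_div_assoc, le_div_iff₀ (by positivity)]
      nlinarith
    · rw [hlogδ2]
      nlinarith
    · rw [div_le_iff₀ (by positivity), mul_div_assoc]
      nlinarith
  · have hK := Nat.le_ceil (9 * (L / φ))
    have hK2 := (Nat.ceil_lt_add_one (show 0 ≤ 9 * (L / φ) by positivity)).le
    set K := ⌈9 * (L / φ)⌉₊
    have hK3 : 9 * L ≤ K * φ := by
      have := mul_le_mul_of_nonneg_right hK hφ0.le
      rwa [mul_assoc, div_mul_cancel₀ _ hφ0.ne'] at this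
    refine (Gossip.syncSpreadingTime_le (K := K) hP hφ1 hδ0 ?_).trans ?_
    · rw [← hφ]
      linarith
    · rw [← ENNReal.ofReal_natCast]
      refine ENNReal.ofReal_le_ofReal ?_
      rw [mul_div_assoc]
      linarith
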